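/- All rings are commutative with unit. For a ring extension $A\subseteq B$, $[A,B]$ denotes the set of intermediate rings and $(A:B)=\{a\in A: aB\subseteq A\}$ the conductor. The extension $A\subseteq B$ is Prüfer if $A\to T$ is a flat epimorphism of commutative rings for every $T\in[A,B]$; quasi-Prüfer if $C\subseteq B$ is Prüfer, where $C$ is the integral closure of $A$ in $B$; almost-Prüfer if there is $T\in[A,B]$ with $A\subseteq T$ Prüfer and $T\subseteq B$ integral. Let $R\subseteq S$ be a quasi-Prüfer extension. For $A\in[R,S]$ let $\overline A$ be the integral closure of $A$ in $S$ and $\widetilde A$ the Prüfer hull of $A$ in $S$ (the compositum of all $T\in[A,S]$ with $A\subseteq T$ Prüfer). Put $\vec R:=\widetilde R\,\overline R$, the subring of $S$ generated by $\widetilde R$ and $\overline R$, and let $\overset{\Longrightarrow}{R}$ be the compositum of all $T\in[R,S]$ with $R\subseteq T$ quasi-Prüfer. Then $\widetilde R$ is the greatest $T\in[R,S]$ with $R\subseteq T$ Prüfer, $\overset{\Longrightarrow}{R}$ is the greatest $T\in[R,S]$ with $R\subseteq T$ quasi-Prüfer, and the following hold. 1. The square of inclusions $R\to\overline R$, $R\to\widetilde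 R$, $\overline R\to\widetilde R\,\overline R$, $\widetilde R\to\widetilde R\,\overline R$ is both a pushout and a pullback in the category of commutative rings. Moreover $\overline R\cap\widetilde R=R$, $(R:\overline R)=(\widetilde R:\widetilde R\,\overline R)\cap R$ and $(\widetilde R:\widetilde R\,\overline R)=(R:\overline R)\widetilde R$. 2. $\widetilde R\,\overline R=\overline{\widetilde R}=\vec R$ and $\overset{\Longrightarrow}{R}=\widetilde{\overline R}=S$; the extension $R\subseteq\vec R$ is almost-Prüfer and $\vec R\subseteq S$ is Prüfer. 3. $R\subseteq S$ is almost-Prüfer if and only if $S=\overline R\,\widetilde R$, and this holds if and only if $\widetilde{\overline R}=\overline{\widetilde R}$. 4. $\vec R$ is the greatest $T\in[R,S]$ such that $R\subseteq T$ is almost-Prüfer, and $\widetilde R$ is equal to the Prüfer hull of $R$ in $\vec R$. 5. If $R\subseteq S$ is almost-Prüfer, then $\mathrm{Supp}_R(S/R)=\mathrm{Supp}_R(\widetilde R/R)\cup\mathrm{Supp}_R(\overline R/R)$, and the same holds with each $\mathrm{Supp}_R(E)=\{P\in\mathrm{Spec}(R): E_P\ne0\}$ replaced by $\mathrm{MSupp}_R(E)=\mathrm{Supp}_R(E)\cap\mathrm{Max}(R)$.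 -/

import Mathlib

universe u

/-- `R ⊆ S` is a Prüfer extension: `R → S` is injective and `R → T` is a flat epimorphism of
commutative rings for every intermediate ring `T`. -/
structure IsPruferExt (R S : Type u) [CommRing R] [CommRing S] [Algebra R S] : Prop where
  injective : Function.Injective (algebraMap R S)
  flat : ∀ T : Subalgebra R S, Module.Flat R T
  epi : ∀ T : Subalgebra R S, Algebra.IsEpi R T

/-- `R ⊆ S` is a quasi-Prüfer extension: the integral closure `R̄` of `R` in `S` is such that
`R̄ ⊆ S` is Prüfer. -/
structure IsQuasiPruferExt (R S : Type u) [CommRing R] [CommRing S] [Algebra R S] : Prop where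
  injective : Function.Injective (algebraMap R S)
  prufer : IsPruferExt (integralClosure R S) S

/-- `R ⊆ S` is an almost-Prüfer extension: it factors as `R ⊆ T ⊆ S` with `R ⊆ T` Prüfer and
`T ⊆ S` integral. -/
def IsAlmostPruferExt (R S : Type u) [CommRing R] [CommRing S] [Algebra R S] : Prop :=
  ∃ T : Subalgebra R S, IsPruferExt R T ∧ Algebra.IsIntegral T S

/-- The Prüfer hull `R̃` of `R` in `S`, the compositum of all Prüfer subextensions `R ⊆ T`. -/
def pruferHull (R S : Type u) [CommRing R] [CommRing S] [Algebra R S] : Subalgebra R S :=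
  sSup {T : Subalgebra R S | IsPruferExt R T}

/-- The quasi-Prüfer hull of `R` in `S`, the compositum of all quasi-Prüfer subextensions. -/
def quasiPruferHull (R S : Type u) [CommRing R] [CommRing S] [Algebra R S] : Subalgebra R S :=
  sSup {T : Subalgebra R S | IsQuasiPruferExt R T}

/-- The subring `R̃ R̄` of `S` generated by the Prüfer hull and the integral closure of `R`. -/
def pruferIntegralHull (R S : Type u) [CommRing R] [CommRing S] [Algebra R S] :
    Subalgebra R S :=
  pruferHull R S ⊔ integralClosure R S

/-- The inclusion `R̃ ⊆ R̃ R̄`. -/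
def pruferHullIncl (R S : Type u) [CommRing R] [CommRing S] [Algebra R S] :
    pruferHull R S →+* pruferIntegralHull R S :=
  (Subalgebra.inclusion (le_sup_left : pruferHull R S ≤ pruferIntegralHull R S)).toRingHom

/-- The inclusion `R̄ ⊆ R̃ R̄`. -/
def integralClosureIncl (R S : Type u) [CommRing R] [CommRing S] [Algebra R S] :
    integralClosure R S →+* pruferIntegralHull R S :=
  (Subalgebra.inclusion
    (le_sup_right : integralClosure R S ≤ pruferIntegralHull R S)).toRingHom

/-- The conductor `(A : B) = {a ∈ A | a B ⊆ A}` of an extension `f : A → B` (`f` injective),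
as an ideal of `A`. -/
def extConductor {A B : Type u} [CommRing A] [CommRing B] (f : A →+* B) : Ideal A where
  carrier := {a | ∀ b : B, f a * b ∈ f.range}
  zero_mem' := fun b => by
    rw [map_zero, zero_mul]
    exact zero_mem _
  add_mem' := fun {x y} hx hy b => by
    rw [map_add, add_mul]
    exact add_mem (hx b) (hy b)
  smul_mem' := fun c x hx b => by
    rw [smul_eq_mul, map_mul, mul_assoc]
    exact mul_mem ⟨c, rfl⟩ (hx b)

/-- The support of the `R`-module `S/R`. -/
def extSupp (R S : Type u) [CommRing R] [CommRing S] [Algebra R S] : Set (PrimeSpectrum R) :=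
  Module.support R (S ⧸ LinearMap.range (Algebra.linearMap R S))

/-- The maximal ideals in the support of the `R`-module `S/R`. -/
def extMSupp (R S : Type u) [CommRing R] [CommRing S] [Algebra R S] : Set (PrimeSpectrum R) :=
  extSupp R S ∩ {P | P.asIdeal.IsMaximal}

/-! Being Prüfer is an elementwise condition (`isPruferExt_iff`): for each `b` in `S` the ideals `(R
: b)` and `R ∩ R b` are comaximal. Comaximality supplies common denominators, hence flatness and
epimorphy. Conversely, a finite epimorphism is surjective, so every intermediate ring is integrally
closed in `S`; then `b ∈ R[b²]`, and this relation yields comaximality.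

The condition can be tested at maximal ideals, where two Prüfer subextensions are comparable, so
composita of Prüfer subextensions are Prüfer. Elements of `R̃` integral over `R` lie in `R`, which
gives the pullback; `R → R̃` being a flat epimorphism gives the pushout. When `R̄ ⊆ S` is Prüfer,
every ring above `R̄` is integrally closed in `S`. Hence `R̃ R̄` is the integral closure of `R̃`,
and the maximality statements follow. -/

open Polynomial TensorProduct

/-! ### The elementwise criterion for Prüfer extensions. -/

section PruferElem

variable {R S : Type*} [CommRing R] [CommRing S] [Algebra R S]

/-- The elementwise form of the Prüfer condition: `1 = x + y b` with `x, y, x b ∈ R`. -/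
def IsPruferElem (R : Type*) {S : Type*} [CommRing R] [CommRing S] [Algebra R S] (b : S) : Prop :=
  ∃ x y z : R, x • b = algebraMap R S z ∧ algebraMap R S x + y • b = 1

/-- The ideal `(R : b) = {r ∈ R | r b ∈ R}`. -/
def denomIdeal (R : Type*) {S : Type*} [CommRing R] [CommRing S] [Algebra R S] (b : S) : Ideal R :=
  (LinearMap.range (Algebra.linearMap R S)).comap (LinearMap.toSpanSingleton R S b)

/-- The ideal `R ∩ R b`. -/
def multipleIdeal (R : Type*) {S : Type*} [CommRing R] [CommRing S] [Algebra R S] (b : S) :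
    Ideal R :=
  (LinearMap.range (LinearMap.toSpanSingleton R S b)).comap (Algebra.linearMap R S)

theorem mem_denomIdeal {b : S} {r : R} :
    r ∈ denomIdeal R b ↔ ∃ z : R, algebraMap R S z = r • b := by
  simp [denomIdeal]

theorem mem_multipleIdeal {b : S} {r : R} :
    r ∈ multipleIdeal R b ↔ ∃ y : R, y • b = algebraMap R S r := by
  simp [multipleIdeal]

theorem isPruferElem_iff_sup_eq_top {b : S} :
    IsPruferElem R b ↔ denomIdeal R b ⊔ multipleIdeal R b = ⊤ := by
  rw [Ideal.eq_top_iff_one, Submodule.mem_sup]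
  constructor
  · rintro ⟨x, y, z, hx, hy⟩
    refine ⟨x, mem_denomIdeal.2 ⟨z, hx.symm⟩, 1 - x, mem_multipleIdeal.2 ⟨y, ?_⟩, by ring⟩
    rw [map_sub, map_one, ← hy]
    ring
  · rintro ⟨x, hx, s, hs, hxs⟩
    obtain ⟨z, hz⟩ := mem_denomIdeal.1 hx
    obtain ⟨y, hy⟩ := mem_multipleIdeal.1 hs
    exact ⟨x, y, z, hz.symm, by rw [hy, ← map_add, hxs, map_one]⟩

/-- Since `x` and `1 - x = y b` are not both in `P`, locally at `P` either `b` or its inverse is a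
fraction from `R`. -/
theorem IsPruferElem.exists_notMem {b : S} (hb : IsPruferElem R b) (P : Ideal R) [P.IsPrime] :
    (∃ x z : R, x ∉ P ∧ x • b = algebraMap R S z) ∨
      ∃ s y : R, s ∉ P ∧ y • b = algebraMap R S s := by
  obtain ⟨x, y, z, hx, hy⟩ := hb
  by_cases hxP : x ∈ P
  · refine .inr ⟨1 - x, y, fun h => ?_, by rw [map_sub, map_one, ← hy]; ring⟩
    exact Ideal.IsPrime.ne_top ‹_› (P.eq_top_iff_one.2 (by simpa using P.add_mem h hxP))
  · exact .inl ⟨x, z, hxP, hx⟩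

theorem isPruferElem_algHom_iff {T : Type*} [CommRing T] [Algebra R T] (f : S →ₐ[R] T)
    (hf : Function.Injective f) {b : S} : IsPruferElem R (f b) ↔ IsPruferElem R b := by
  simp_rw [IsPruferElem, ← map_smul, ← f.commutes, ← map_add, ← map_one f, hf.eq_iff]

theorem isPruferElem_coe_iff {T : Subalgebra R S} {b : T} :
    IsPruferElem R (b : S) ↔ IsPruferElem R b :=
  isPruferElem_algHom_iff T.val Subtype.val_injective

theorem isPruferElem_algebraMap (r : R) : IsPruferElem R (algebraMap R S r) :=
  ⟨1, 0, r, by simp, by simp⟩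

theorem IsPruferElem.of_le {A B : Subalgebra R S} (h : A ≤ B) {b : S} (hb : IsPruferElem A b) :
    IsPruferElem B b := by
  obtain ⟨x, y, z, hx, hy⟩ := hb
  exact ⟨Subalgebra.inclusion h x, Subalgebra.inclusion h y, Subalgebra.inclusion h z, hx, hy⟩

/-- In `1 = x + y b` both `x` and `y` are denominators of `b`, because `y b = 1 - x`. -/
theorem map_denomIdeal_eq_top {b : S} (hb : IsPruferElem R b) :
    (denomIdeal R b).map (algebraMap R S) = ⊤ := by
  obtain ⟨x, y, z, hx, hy⟩ := hb
  rw [Ideal.eq_top_iff_one, ← hy, Algebra.smul_def]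
  refine add_mem (Ideal.mem_map_of_mem _ (mem_denomIdeal.2 ⟨z, hx.symm⟩))
    (Ideal.mul_mem_right _ _ (Ideal.mem_map_of_mem _ (mem_denomIdeal.2 ⟨1 - x, ?_⟩)))
  rw [map_sub, map_one, ← hy]
  ring

/-- Finitely many Prüfer elements admit common denominators generating the unit ideal. -/
theorem exists_sum_common_denominators {ι : Type*} [Fintype ι] {x : ι → S}
    (hx : ∀ i, IsPruferElem R (x i)) :
    ∃ (n : ℕ) (r : Fin n → R) (c : Fin n → S) (z : ι → Fin n → R),
      ∑ k, r k • c k = 1 ∧ ∀ i k, algebraMap R S (z i k) = r k • x i := by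
  have htop : (∏ i, denomIdeal R (x i)).map (algebraMap R S) = ⊤ := by
    rw [← Ideal.mapHom_apply, map_prod]
    simp [map_denomIdeal_eq_top (hx _), ← Ideal.one_eq_top]
  have h1 : (1 : S) ∈ Submodule.span S
      ((algebraMap R S) '' ((∏ i, denomIdeal R (x i) : Ideal R) : Set R)) := by
    have : (1 : S) ∈ (∏ i, denomIdeal R (x i)).map (algebraMap R S) := by simp [htop]
    exact this
  obtain ⟨n, c, g, h⟩ := Submodule.mem_span_set'.1 h1
  choose r hr hrg using fun k => (g k).2
  have hz (i : ι) (k : Fin n) : ∃ z : R, algebraMap R S z = r k • x i :=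
    mem_denomIdeal.1 ((Ideal.prod_le_inf.trans (Finset.inf_le (Finset.mem_univ i))) (hr k))
  choose z hz using hz
  refine ⟨n, r, c, z, ?_, hz⟩
  rw [← h]
  exact Finset.sum_congr rfl fun k _ => by rw [← hrg, Algebra.smul_def, smul_eq_mul, mul_comm]

/-- Equational criterion: the `c k` trivialize the relation, with coefficients `z i k = r k • x i`
that satisfy it in `R` by injectivity. -/
theorem flat_of_forall_isPruferElem (hinj : Function.Injective (algebraMap R S))
    (h : ∀ b : S, IsPruferElem R b) : Module.Flat R S := by
  refine Module.Flat.of_forall_isTrivialRelation fun {l f x} hfx => ?_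
  obtain ⟨n, r, c, z, h1, hz⟩ := exists_sum_common_denominators fun i => h (x i)
  refine ⟨n, z, c, fun i => ?_, fun k => hinj ?_⟩
  · calc x i = x i * ∑ k, r k • c k := by rw [h1, mul_one]
      _ = ∑ k, z i k • c k := by
        rw [Finset.mul_sum]
        refine Finset.sum_congr rfl fun k _ => ?_
        rw [Algebra.smul_def (z i k), hz, mul_smul_comm, smul_mul_assoc]
  · simp_rw [map_sum, map_mul, hz, ← Algebra.smul_def, smul_comm _ (r k), ← Finset.smul_sum, hfx]
    simp

theorem isEpi_of_forall_isPruferElem (h : ∀ b : S, IsPruferElem R b) : Algebra.IsEpi R S := by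
  refine (Algebra.isEpi_iff_forall_one_tmul_eq R S).2 fun b => ?_
  obtain ⟨n, r, c, z, h1, hz⟩ := exists_sum_common_denominators fun _ : Unit => h b
  have hz' (k : Fin n) : z () k • (1 : S) = r k • b := by
    rw [← hz () k, Algebra.algebraMap_eq_smul_one]
  calc (1 : S) ⊗ₜ[R] b = 1 ⊗ₜ[R] (b * ∑ k, r k • c k) := by rw [h1, mul_one]
    _ = ∑ k, (1 : S) ⊗ₜ[R] (z () k • c k) := by
      rw [Finset.mul_sum, TensorProduct.tmul_sum]
      refine Finset.sum_congr rfl fun k _ => ?_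
      rw [Algebra.smul_def (z () k), hz, mul_smul_comm, smul_mul_assoc]
    _ = ∑ k, b ⊗ₜ[R] (r k • c k) := by
      refine Finset.sum_congr rfl fun k _ => ?_
      rw [← smul_tmul, hz', smul_tmul]
    _ = b ⊗ₜ[R] 1 := by rw [← TensorProduct.tmul_sum, h1]

theorem isEpi_of_isScalarTower {A : Type*} [CommRing A] [Algebra R A] [Algebra A S]
    [IsScalarTower R A S] [Algebra.IsEpi R S] : Algebra.IsEpi A S := by
  refine (Algebra.isEpi_iff_forall_one_tmul_eq A S).2 fun b => ?_
  simpa using congrArg (TensorProduct.mapOfCompatibleSMul A R R S S)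
    ((Algebra.isEpi_iff_forall_one_tmul_eq R S).1 ‹_› b)

/-- `A → A[b]` is a finite epimorphism, hence surjective. -/
theorem mem_of_isIntegral_of_isEpi (h : ∀ T : Subalgebra R S, Algebra.IsEpi R T)
    (A : Subalgebra R S) {b : S} (hb : IsIntegral A b) : b ∈ A := by
  have : Module.Finite A (Algebra.adjoin A {b}) := Algebra.finite_adjoin_simple_of_isIntegral hb
  have : Algebra.IsEpi R (Algebra.adjoin A {b}) := h ((Algebra.adjoin A {b}).restrictScalars R)
  have : Algebra.IsEpi A (Algebra.adjoin A {b}) := isEpi_of_isScalarTower (R := R)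
  obtain ⟨a, ha⟩ := Algebra.isEpi_iff_surjective_algebraMap_of_finite.1 this
    ⟨b, Algebra.self_mem_adjoin_singleton A b⟩
  have hab : (a : S) = b := congrArg Subtype.val ha
  exact hab ▸ a.2

/-- If `a` is the leading coefficient, `a b` is integral, so it comes from some `c` in `R`.
Replacing `a X^(m+1)` by `c X^m` lowers the degree and alters the lower coefficients only by an
element of the ideal. -/
theorem coeff_mem_of_aeval_eq_zero (hR : ∀ s : S, IsIntegral R s → s ∈ (algebraMap R S).range)
    {b : S} (n : ℕ) (p : R[X]) (hn : p.natDegree ≤ n) (hp : aeval b p = 0) (i : ℕ) :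
    p.coeff i ∈ denomIdeal R b ⊔ multipleIdeal R b := by
  induction n generalizing p i with
  | zero =>
    obtain ⟨a, rfl⟩ := natDegree_eq_zero.1 (Nat.le_zero.1 hn)
    rw [coeff_C]
    split_ifs
    -- The constant need not vanish in `R`, but its image in `S` is `0 • b`.
    · exact Ideal.mem_sup_right (mem_multipleIdeal.2 ⟨0, by simpa using hp.symm⟩)
    · exact zero_mem _
  | succ m ih =>
    rcases hn.lt_or_eq with hlt | heq
    · exact ih p (Nat.lt_succ_iff.1 hlt) hp i
    obtain ⟨c, hc⟩ := hR _ (isIntegral_leadingCoeff_smul p b hp)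
    have ha : p.leadingCoeff ∈ denomIdeal R b ⊔ multipleIdeal R b :=
      Ideal.mem_sup_left (mem_denomIdeal.2 ⟨c, hc⟩)
    have hcJ : c ∈ denomIdeal R b ⊔ multipleIdeal R b :=
      Ideal.mem_sup_right (mem_multipleIdeal.2 ⟨_, hc.symm⟩)
    have hq : ∀ i, (p.eraseLead + C c * X ^ m).coeff i ∈ denomIdeal R b ⊔ multipleIdeal R b := by
      refine ih _ ?_ ?_
      · refine (natDegree_add_le _ _).trans (max_le ?_ (natDegree_C_mul_X_pow_le _ _))
        exact p.eraseLead_natDegree_le.trans (by omega)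
      · have := congrArg (aeval b) p.eraseLead_add_C_mul_X_pow
        rw [hp, heq] at this
        rw [map_add] at this ⊢
        rw [← this]
        simp only [map_mul, aeval_C, map_pow, aeval_X, hc, Algebra.smul_def]
        ring
    by_cases hi : i = m + 1
    · rw [hi, ← heq]
      exact ha
    · have h := hq i
      rw [coeff_add, eraseLead_coeff_of_ne _ (heq ▸ hi), coeff_C_mul_X_pow] at h
      split_ifs at h
      · exact (Submodule.add_mem_iff_left _ hcJ).1 h
      · simpa using h

theorem isPruferElem_of_forall_isEpi (h : ∀ T : Subalgebra R S, Algebra.IsEpi R T) (b : S) :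
    IsPruferElem R b := by
  have hR (s : S) (hs : IsIntegral R s) : s ∈ (algebraMap R S).range :=
    Algebra.mem_bot.1 (mem_of_isIntegral_of_isEpi h ⊥ hs.tower_top)
  have hb : b ∈ Algebra.adjoin R {b ^ 2} := by
    refine mem_of_isIntegral_of_isEpi h _ (IsIntegral.of_pow two_pos ?_)
    exact isIntegral_algebraMap (x := (⟨b ^ 2, Algebra.self_mem_adjoin_singleton R _⟩ :
      Algebra.adjoin R {b ^ 2}))
  rw [Algebra.adjoin_singleton_eq_range_aeval] at hb
  obtain ⟨f, hf⟩ := hb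
  rw [isPruferElem_iff_sup_eq_top, Ideal.eq_top_iff_one]
  -- The relation `b = f(b²)` has only even powers on the right, so `X - f(X²)` has linear
  -- coefficient `1`.
  have := coeff_mem_of_aeval_eq_zero hR _ (X - expand R 2 f) le_rfl
    (by rw [map_sub, aeval_X, expand_aeval, sub_eq_zero]; exact hf.symm) 1
  simpa [coeff_expand two_pos] using this

end PruferElem

/-! ### Composita of Prüfer subextensions. -/

section PruferExt

variable {R S : Type u} [CommRing R] [CommRing S] [Algebra R S]

theorem isPruferExt_iff :
    IsPruferExt R S ↔ Function.Injective (algebraMap R S) ∧ ∀ b : S, IsPruferElem R b := by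
  refine ⟨fun h => ⟨h.injective, isPruferElem_of_forall_isEpi h.epi⟩, fun ⟨hinj, h⟩ => ?_⟩
  have hT (T : Subalgebra R S) (b : T) : IsPruferElem R b := isPruferElem_coe_iff.1 (h b)
  refine ⟨hinj, fun T => flat_of_forall_isPruferElem (fun x y hxy => hinj ?_) (hT T),
    fun T => isEpi_of_forall_isPruferElem (hT T)⟩
  exact congrArg Subtype.val hxy

theorem isPruferExt_subalgebra_iff {T : Subalgebra R S} :
    IsPruferExt R T ↔ Function.Injective (algebraMap R S) ∧ ∀ b ∈ T, IsPruferElem R b := by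
  rw [isPruferExt_iff]
  exact and_congr (Subtype.val_injective.of_comp_iff (algebraMap R T)).symm
    ⟨fun h b hb => isPruferElem_coe_iff.2 (h ⟨b, hb⟩), fun h b => isPruferElem_coe_iff.1 (h b b.2)⟩

theorem IsPruferExt.mem_range_of_isIntegral (h : IsPruferExt R S) {s : S} (hs : IsIntegral R s) :
    s ∈ (algebraMap R S).range :=
  Algebra.mem_bot.1 (mem_of_isIntegral_of_isEpi h.epi ⊥ hs.tower_top)

/-- The elements of `S` which lie in `T` after multiplication by an element of `M`. -/
def Subalgebra.locallyAt (T : Subalgebra R S) (M : Submonoid R) : Subalgebra R S where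
  carrier := {s | ∃ r ∈ M, r • s ∈ T}
  algebraMap_mem' a := ⟨1, M.one_mem, by simp⟩
  add_mem' := by
    rintro a b ⟨r, hr, ha⟩ ⟨s, hs, hb⟩
    refine ⟨r * s, M.mul_mem hr hs, ?_⟩
    rw [smul_add, mul_smul, smul_comm, mul_smul]
    exact add_mem (T.smul_mem ha _) (T.smul_mem hb _)
  mul_mem' := by
    rintro a b ⟨r, hr, ha⟩ ⟨s, hs, hb⟩
    exact ⟨r * s, M.mul_mem hr hs, by rw [← smul_mul_smul_comm]; exact T.mul_mem ha hb⟩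

theorem Subalgebra.le_locallyAt (T : Subalgebra R S) (M : Submonoid R) : T ≤ T.locallyAt M :=
  fun s hs => ⟨1, M.one_mem, by simpa⟩

/-- Prüfer subextensions are comparable after localization at a prime ideal. -/
theorem le_locallyAt_or_le_locallyAt {T U : Subalgebra R S} (hT : ∀ t ∈ T, IsPruferElem R t)
    (hU : ∀ u ∈ U, IsPruferElem R u) (P : Ideal R) [P.IsPrime] :
    T ≤ U.locallyAt P.primeCompl ∨ U ≤ T.locallyAt P.primeCompl := by
  by_contra! H
  obtain ⟨⟨t, htT, htU⟩, u, huU, huT⟩ := And.imp SetLike.not_le_iff_exists.1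
    SetLike.not_le_iff_exists.1 H
  rcases (hU u huU).exists_notMem P with ⟨x, z, hx, hxz⟩ | ⟨q, y, hq, hyq⟩
  · exact huT ⟨x, hx, hxz ▸ T.algebraMap_mem z⟩
  -- As `y u = q` is outside `P`, `y • t` plays the role of the quotient `t / u`.
  rcases (hT (y • t) (T.smul_mem htT y)).exists_notMem P with ⟨x, z, hx, hxz⟩ | ⟨s, w, hs, hws⟩
  · refine htU ⟨x * q, P.primeCompl.mul_mem hx hq, ?_⟩
    have : (x * q) • t = z • u := by
      rw [Algebra.smul_def z, ← hxz, Algebra.smul_def (x * q), map_mul, ← hyq]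
      simp only [Algebra.smul_def]
      ring
    exact this ▸ U.smul_mem huU z
  · refine huT ⟨s, hs, ?_⟩
    have : s • u = (w * q) • t := by
      rw [Algebra.smul_def s, ← hws, Algebra.smul_def (w * q), map_mul, ← hyq]
      simp only [Algebra.smul_def]
      ring
    exact this ▸ T.smul_mem htT _

/-- Comaximality is tested at a maximal ideal, where one of `T`, `U` locally contains the other and
hence the compositum. -/
theorem isPruferElem_of_mem_sup {T U : Subalgebra R S} (hT : ∀ t ∈ T, IsPruferElem R t)
    (hU : ∀ u ∈ U, IsPruferElem R u) {b : S} (hb : b ∈ T ⊔ U) : IsPruferElem R b := by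
  rw [isPruferElem_iff_sup_eq_top]
  by_contra hne
  obtain ⟨P, hP, hle⟩ := Ideal.exists_le_maximal _ hne
  obtain ⟨r, hr, hrb⟩ : ∃ r ∉ P, IsPruferElem R (r • b) := by
    rcases le_locallyAt_or_le_locallyAt hT hU P with h | h
    · obtain ⟨r, hr, hrb⟩ := sup_le h (U.le_locallyAt _) hb
      exact ⟨r, hr, hU _ hrb⟩
    · obtain ⟨r, hr, hrb⟩ := sup_le (T.le_locallyAt _) h hb
      exact ⟨r, hr, hT _ hrb⟩
  rcases hrb.exists_notMem P with ⟨x, z, hx, hxz⟩ | ⟨s, y, hs, hys⟩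
  · refine P.primeCompl.mul_mem hx hr (hle (Ideal.mem_sup_left (mem_denomIdeal.2 ⟨z, ?_⟩)))
    rw [mul_smul, hxz]
  · refine hs (hle (Ideal.mem_sup_right (mem_multipleIdeal.2 ⟨y * r, ?_⟩)))
    rw [mul_smul, hys]

theorem isPruferExt_pruferHull (hinj : Function.Injective (algebraMap R S)) :
    IsPruferExt R (pruferHull R S) := by
  refine isPruferExt_subalgebra_iff.2 ⟨hinj, fun b hb => ?_⟩
  have hdir : Directed (· ≤ ·) fun T : {T : Subalgebra R S | IsPruferExt R T} => T.1 := by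
    intro T U
    exact ⟨⟨T.1 ⊔ U.1, isPruferExt_subalgebra_iff.2 ⟨hinj, fun b hb => isPruferElem_of_mem_sup
      (isPruferExt_subalgebra_iff.1 T.2).2 (isPruferExt_subalgebra_iff.1 U.2).2 hb⟩⟩,
      le_sup_left, le_sup_right⟩
  have : Nonempty {T : Subalgebra R S | IsPruferExt R T} := by
    refine ⟨⊥, isPruferExt_subalgebra_iff.2 ⟨hinj, fun b hb => ?_⟩⟩
    obtain ⟨r, rfl⟩ := Algebra.mem_bot.1 hb
    exact isPruferElem_algebraMap r
  rw [pruferHull, sSup_eq_iSup', ← SetLike.mem_coe, Subalgebra.coe_iSup_of_directed hdir,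
    Set.mem_iUnion] at hb
  obtain ⟨T, hT⟩ := hb
  exact (isPruferExt_subalgebra_iff.1 T.2).2 b hT

theorem isGreatest_pruferHull (hinj : Function.Injective (algebraMap R S)) :
    IsGreatest {T : Subalgebra R S | IsPruferExt R T} (pruferHull R S) :=
  ⟨isPruferExt_pruferHull hinj, fun _ hT => le_sSup hT⟩

end PruferExt

/-! ### Hulls and integral closures. -/

section Hulls

variable {R S : Type u} [CommRing R] [CommRing S] [Algebra R S]

theorem IsPruferExt.of_subalgebra_le {A B : Subalgebra R S} (h : A ≤ B) (hA : IsPruferExt A S) :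
    IsPruferExt B S :=
  isPruferExt_iff.2 ⟨Subtype.val_injective, fun b => ((isPruferExt_iff.1 hA).2 b).of_le h⟩

theorem IsPruferExt.mem_of_isIntegral {A : Subalgebra R S} (hA : IsPruferExt A S) {s : S}
    (hs : IsIntegral A s) : s ∈ A := by
  obtain ⟨a, rfl⟩ := hA.mem_range_of_isIntegral hs
  exact a.2

theorem pruferHull_eq_top (h : IsPruferExt R S) : pruferHull R S = ⊤ :=
  top_le_iff.1 <| le_sSup <| isPruferExt_subalgebra_iff.2
    ⟨h.injective, fun b _ => (isPruferExt_iff.1 h).2 b⟩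

theorem isIntegral_of_subalgebra_le {A B : Subalgebra R S} (h : A ≤ B) {s : S}
    (hs : IsIntegral A s) : IsIntegral B s :=
  hs.map_of_comp_eq (Subalgebra.inclusion h).toRingHom (RingHom.id S) rfl

theorem IsQuasiPruferExt.top (h : IsQuasiPruferExt R S) :
    IsQuasiPruferExt R (⊤ : Subalgebra R S) := by
  refine ⟨fun x y hxy => h.injective (congrArg Subtype.val hxy),
    isPruferExt_iff.2 ⟨Subtype.val_injective, fun b => ?_⟩⟩
  have hmem (x : integralClosure R S) : (⟨x, trivial⟩ : (⊤ : Subalgebra R S)) ∈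
      integralClosure R (⊤ : Subalgebra R S) :=
    (isIntegral_algHom_iff (Subalgebra.val ⊤) Subtype.val_injective).1 x.2
  obtain ⟨x, y, z, hx, hy⟩ := (isPruferExt_iff.1 h.prufer).2 b
  exact ⟨⟨_, hmem x⟩, ⟨_, hmem y⟩, ⟨_, hmem z⟩, Subtype.ext hx, Subtype.ext hy⟩

theorem quasiPruferHull_eq_top (h : IsQuasiPruferExt R S) : quasiPruferHull R S = ⊤ :=
  top_le_iff.1 (le_sSup h.top)

theorem isPruferExt_pruferIntegralHull (h : IsQuasiPruferExt R S) :
    IsPruferExt (pruferIntegralHull R S) S :=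
  h.prufer.of_subalgebra_le le_sup_right

/-- The compositum is generated by elements integral over `R̃`; it is integrally closed in `S`
because `S` is Prüfer over it. -/
theorem mem_pruferIntegralHull_iff (h : IsQuasiPruferExt R S) {s : S} :
    s ∈ pruferIntegralHull R S ↔ IsIntegral (pruferHull R S) s := by
  refine ⟨fun hs => ?_, fun hs => (isPruferExt_pruferIntegralHull h).mem_of_isIntegral
    (isIntegral_of_subalgebra_le le_sup_left hs)⟩
  have hle : pruferIntegralHull R S ≤ (integralClosure (pruferHull R S) S).restrictScalars R := by
    refine sup_le (fun x hx => ?_) (fun x hx => ?_)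
    · exact isIntegral_algebraMap (x := (⟨x, hx⟩ : pruferHull R S))
    · exact IsIntegral.tower_top hx
  exact hle hs

theorem pruferIntegralHull_eq (h : IsQuasiPruferExt R S) :
    pruferIntegralHull R S = (integralClosure (pruferHull R S) S).restrictScalars R :=
  Subalgebra.ext fun _ => mem_pruferIntegralHull_iff h

/-- Moves the intermediate ring from inside `V` to inside `S`, where it can be compared with `R̃`.
-/
theorem isAlmostPruferExt_subalgebra_iff {V : Subalgebra R S} :
    IsAlmostPruferExt R V ↔
      ∃ U ≤ V, IsPruferExt R U ∧ ∀ s ∈ V, IsIntegral U s := by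
  constructor
  · rintro ⟨T, hT, hTV⟩
    refine ⟨T.map V.val, ?_, isPruferExt_subalgebra_iff.2 ⟨?_, ?_⟩, fun s hs => ?_⟩
    · rintro _ ⟨t, -, rfl⟩
      exact t.2
    · exact Subtype.val_injective.comp (Subtype.val_injective.comp hT.injective)
    · rintro _ ⟨t, ht, rfl⟩
      exact isPruferElem_coe_iff.2 ((isPruferExt_subalgebra_iff.1 hT).2 t ht)
    · exact (hTV.isIntegral ⟨s, hs⟩).map_of_comp_eq
        ((V.val.comp T.val).codRestrict (T.map V.val) fun t => ⟨t, t.2, rfl⟩).toRingHom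
        V.val.toRingHom rfl
  · rintro ⟨U, hUV, hU, hVU⟩
    have hU' := isPruferExt_subalgebra_iff.1 hU
    refine ⟨U.comap V.val, isPruferExt_subalgebra_iff.2 ⟨fun x y hxy => ?_, fun b hb => ?_⟩,
      ⟨fun v => ?_⟩⟩
    · exact hU'.1 (congrArg Subtype.val hxy)
    · exact isPruferElem_coe_iff.1 (hU'.2 b hb)
    · rw [← isIntegral_algebraMap_iff (A := V) (B := S) Subtype.val_injective]
      exact (hVU v v.2).map_of_comp_eq
        (((Subalgebra.inclusion hUV).codRestrict (U.comap V.val) fun u => u.2).toRingHom)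
        (RingHom.id S) rfl

theorem isAlmostPruferExt_iff_sup_eq_top (h : IsQuasiPruferExt R S) :
    IsAlmostPruferExt R S ↔ integralClosure R S ⊔ pruferHull R S = ⊤ := by
  rw [sup_comm, ← pruferIntegralHull, eq_top_iff]
  constructor
  · rintro ⟨T, hT, hTS⟩ s -
    exact (mem_pruferIntegralHull_iff h).2
      (isIntegral_of_subalgebra_le (le_sSup hT) (hTS.isIntegral s))
  · exact fun htop => ⟨_, isPruferExt_pruferHull h.injective,
      ⟨fun s => (mem_pruferIntegralHull_iff h).1 (htop trivial)⟩⟩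

theorem isGreatest_pruferIntegralHull (h : IsQuasiPruferExt R S) :
    IsGreatest {T : Subalgebra R S | IsAlmostPruferExt R T} (pruferIntegralHull R S) := by
  refine ⟨isAlmostPruferExt_subalgebra_iff.2 ⟨_, le_sup_left, isPruferExt_pruferHull h.injective,
    fun s => (mem_pruferIntegralHull_iff h).1⟩, fun T hT s hs => ?_⟩
  obtain ⟨U, -, hU, hUT⟩ := isAlmostPruferExt_subalgebra_iff.1 hT
  exact (mem_pruferIntegralHull_iff h).2 (isIntegral_of_subalgebra_le (le_sSup hU) (hUT s hs))

/-- The elementwise condition does not depend on the ambient ring. -/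
theorem pruferHull_eq_map_pruferHull (hinj : Function.Injective (algebraMap R S))
    {V : Subalgebra R S} (hV : pruferHull R S ≤ V) :
    pruferHull R S = (pruferHull R V).map V.val := by
  have hinjV : Function.Injective (algebraMap R V) := Function.Injective.of_comp
    (f := Subtype.val) hinj
  apply le_antisymm
  · intro s hs
    refine ⟨⟨s, hV hs⟩, ?_, rfl⟩
    have hle : (pruferHull R S).comap V.val ≤ pruferHull R V := by
      refine le_sSup (isPruferExt_subalgebra_iff.2 ⟨hinjV, fun b hb => ?_⟩)
      exact isPruferElem_coe_iff.1
        ((isPruferExt_subalgebra_iff.1 (isPruferExt_pruferHull hinj)).2 b hb)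
    exact hle hs
  · refine (isGreatest_pruferHull hinj).2 (isPruferExt_subalgebra_iff.2 ⟨hinj, ?_⟩)
    rintro _ ⟨b, hb, rfl⟩
    exact isPruferElem_coe_iff.2
      ((isPruferExt_subalgebra_iff.1 (isPruferExt_pruferHull hinjV)).2 b hb)

theorem integralClosure_inf_pruferHull (hinj : Function.Injective (algebraMap R S)) :
    integralClosure R S ⊓ pruferHull R S = ⊥ := by
  refine le_bot_iff.1 fun s ⟨hs, hs'⟩ => ?_
  obtain ⟨r, hr⟩ := (isPruferExt_pruferHull hinj).mem_range_of_isIntegral (s := ⟨s, hs'⟩)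
    ((isIntegral_algHom_iff (pruferHull R S).val Subtype.val_injective).1 hs)
  exact Algebra.mem_bot.2 ⟨r, congrArg Subtype.val hr⟩

/-! ### The pushout and pullback square. -/

section Square

/-- The commutative square of two subalgebras and their compositum is a pullback when
the subalgebras meet in the base ring. -/
theorem isPullback_of_inf_eq_bot (hinj : Function.Injective (algebraMap R S))
    {A B C : Subalgebra R S} (hA : A ≤ C) (hB : B ≤ C) (h : A ⊓ B = ⊥) :
    CategoryTheory.IsPullback (CommRingCat.ofHom (algebraMap R A))
      (CommRingCat.ofHom (algebraMap R B))
      (CommRingCat.ofHom (Subalgebra.inclusion hA).toRingHom)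
      (CommRingCat.ofHom (Subalgebra.inclusion hB).toRingHom) := by
  refine CategoryTheory.IsPullback.of_map (CategoryTheory.forget CommRingCat) rfl ?_
  refine (CategoryTheory.Limits.Types.isPullback_iff _ _ _ _).2
    ⟨rfl, fun x y hxy => hinj (congrArg Subtype.val hxy.1), fun a b hab => ?_⟩
  have hab' : (a : A).1 = (b : B).1 := congrArg Subtype.val hab
  obtain ⟨r, hr⟩ : (a : A).1 ∈ (⊥ : Subalgebra R S) := h ▸ ⟨a.2, hab' ▸ b.2⟩
  exact ⟨r, Subtype.ext hr, Subtype.ext (hr.trans hab')⟩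

theorem isPushout_of_linearDisjoint {A B : Subalgebra R S} (h : A.LinearDisjoint B)
    {C : Subalgebra R S} (hA : A ≤ C) (hB : B ≤ C) (hC : A ⊔ B = C) :
    CategoryTheory.IsPushout (CommRingCat.ofHom (algebraMap R A))
      (CommRingCat.ofHom (algebraMap R B))
      (CommRingCat.ofHom (Subalgebra.inclusion hA).toRingHom)
      (CommRingCat.ofHom (Subalgebra.inclusion hB).toRingHom) := by
  subst hC
  refine (CommRingCat.isPushout_tensorProduct R A B).of_iso (CategoryTheory.Iso.refl _)
    (CategoryTheory.Iso.refl _) (CategoryTheory.Iso.refl _)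
    h.mulMap.toRingEquiv.toCommRingCatIso (by simp) (by simp) ?_ ?_
  · ext a
    exact mul_one (a : S)
  · ext b
    exact one_mul (b : S)

/-- For a flat epimorphism `R → A`, tensoring an `R`-submodule of `S` with `A` gives its `A`-span;
for `B` this is `mulMap`. -/
theorem linearDisjoint_of_isPruferExt {A : Subalgebra R S} (B : Subalgebra R S)
    (hA : IsPruferExt R A) : A.LinearDisjoint B := by
  have h := (isPruferExt_iff.1 hA).2
  have := flat_of_forall_isPruferElem hA.injective h
  have := isEpi_of_forall_isPruferElem h
  rw [Subalgebra.linearDisjoint_iff_injective]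
  have hmap (z : A ⊗[R] B) :
      A.mulMap B z = ((Subalgebra.toSubmodule B).tensorToSpan A z).1 := by
    induction z with
    | zero => rw [map_zero, map_zero]; rfl
    | tmul a b => rfl
    | add x y hx hy => rw [map_add, hx, hy, map_add]; rfl
  exact fun x y hxy => (Subalgebra.toSubmodule B).injective_tensorToSpan A
    (Subtype.ext ((hmap x).symm.trans (hxy.trans (hmap y))))

end Square

/-! ### Conductors. -/

section Conductor

theorem mem_extConductor {A B : Type u} [CommRing A] [CommRing B] {f : A →+* B} {a : A} :
    a ∈ extConductor f ↔ ∀ b : B, f a * b ∈ f.range := Iff.rfl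

/-- Products `t c` span `R̃ R̄`, and `r (t c) = t (r c)` with `r c ∈ R`. Conversely, `r c` lies in
`R̄ ∩ R̃ = R`. -/
theorem extConductor_integralClosure (hinj : Function.Injective (algebraMap R S)) :
    extConductor (algebraMap R (integralClosure R S)) =
      (extConductor (pruferHullIncl R S)).comap (algebraMap R (pruferHull R S)) := by
  ext r
  rw [Ideal.mem_comap, mem_extConductor, mem_extConductor]
  constructor
  · intro hr b
    suffices H : ∀ s ∈ pruferIntegralHull R S, r • s ∈ pruferHull R S by
      exact ⟨⟨_, H b b.2⟩, Subtype.ext (Algebra.smul_def r b.1)⟩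
    intro s hs
    rw [pruferIntegralHull, ← SetLike.mem_coe, ← Subalgebra.coe_toSubmodule,
      ← Subalgebra.mul_toSubmodule] at hs
    induction hs using Submodule.mul_induction_on' with
    | mem_mul_mem t ht c hc =>
      obtain ⟨x, hx⟩ := hr ⟨c, hc⟩
      have hx' : algebraMap R S x = r • c := by
        rw [Algebra.smul_def]
        exact congrArg Subtype.val hx
      rw [← mul_smul_comm, ← hx']
      exact mul_mem ht (Subalgebra.algebraMap_mem _ x)
    | add x _ y _ hx hy =>
      rw [smul_add]
      exact add_mem hx hy
  · intro hr c
    obtain ⟨t, ht⟩ := hr (integralClosureIncl R S c)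
    have ht' : (t : S) = algebraMap R S r * c := congrArg Subtype.val ht
    have hmem : algebraMap R S r * c ∈ integralClosure R S ⊓ pruferHull R S :=
      ⟨mul_mem (Subalgebra.algebraMap_mem _ r) c.2, ht' ▸ t.2⟩
    rw [integralClosure_inf_pruferHull hinj] at hmem
    obtain ⟨x, hx⟩ := hmem
    exact ⟨x, Subtype.ext hx⟩

/-- Every ideal of a Prüfer extension is extended from the base ring. -/
theorem IsPruferExt.map_comap_eq (h : IsPruferExt R S) (J : Ideal S) :
    (J.comap (algebraMap R S)).map (algebraMap R S) = J := by
  refine le_antisymm Ideal.map_comap_le fun j hj => ?_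
  obtain ⟨x, y, z, hx, hy⟩ := (isPruferExt_iff.1 h).2 j
  have hmem {a b : R} (hab : algebraMap R S a = b • j) :
      algebraMap R S a ∈ (J.comap (algebraMap R S)).map (algebraMap R S) := by
    refine Ideal.mem_map_of_mem _ (Ideal.mem_comap.2 ?_)
    rw [hab, Algebra.smul_def]
    exact J.mul_mem_left _ hj
  have hy' : algebraMap R S (1 - x) = y • j := by
    rw [map_sub, map_one, ← hy]
    ring
  -- Both `z = x j` and `1 - x = y j` lie in the contraction of `J`.
  have : j = algebraMap R S z + algebraMap R S (1 - x) * j := by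
    rw [← hx, map_sub, Algebra.smul_def, map_one]
    ring
  rw [this]
  exact add_mem (hmem hx.symm) (Ideal.mul_mem_right _ _ (hmem hy'))

end Conductor

/-! ### Supports. -/

section Support

theorem notMem_extSupp_iff {P : PrimeSpectrum R} :
    P ∉ extSupp R S ↔ ∀ s : S, s ∈ (⊥ : Subalgebra R S).locallyAt P.asIdeal.primeCompl := by
  rw [extSupp, Module.notMem_support_iff', (Submodule.Quotient.mk_surjective _).forall]
  refine forall_congr' fun s => exists_congr fun r => and_congr Iff.rfl ?_
  rw [← Submodule.Quotient.mk_smul, Submodule.Quotient.mk_eq_zero]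
  exact Iff.rfl

theorem notMem_extSupp_subalgebra_iff {T : Subalgebra R S} {P : PrimeSpectrum R} :
    P ∉ extSupp R T ↔ T ≤ (⊥ : Subalgebra R S).locallyAt P.asIdeal.primeCompl := by
  rw [notMem_extSupp_iff, SetLike.le_def, Subtype.forall]
  refine forall₂_congr fun s hs => exists_congr fun r => and_congr Iff.rfl ?_
  simp only [Algebra.mem_bot, Set.mem_range]
  exact exists_congr fun x => Subtype.ext_iff

/-- Being outside the support means containment in a fixed subring `locallyAt`, which contains a
compositum exactly when it contains both factors. -/
theorem extSupp_eq_union {A B : Subalgebra R S} (h : A ⊔ B = ⊤) :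
    extSupp R S = extSupp R A ∪ extSupp R B := by
  ext P
  rw [← not_iff_not, Set.mem_union, not_or, notMem_extSupp_subalgebra_iff,
    notMem_extSupp_subalgebra_iff, ← sup_le_iff, h, notMem_extSupp_iff]
  exact ⟨fun h s _ => h s, fun h s => h trivial⟩

end Support

end Hulls

theorem theorem4p5 {R S : Type u} [CommRing R] [CommRing S] [Algebra R S]
    (hRS : IsQuasiPruferExt R S) :
    -- the hulls are the greatest subextensions of their kinds
    IsGreatest {T : Subalgebra R S | IsPruferExt R T} (pruferHull R S) ∧
    IsGreatest {T : Subalgebra R S | IsQuasiPruferExt R T} (quasiPruferHull R S) ∧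
    -- pushout, pullback, intersection, conductors
    (CategoryTheory.IsPushout
        (CommRingCat.ofHom (algebraMap R (integralClosure R S)))
        (CommRingCat.ofHom (algebraMap R (pruferHull R S)))
        (CommRingCat.ofHom (integralClosureIncl R S))
        (CommRingCat.ofHom (pruferHullIncl R S)) ∧
      CategoryTheory.IsPullback
        (CommRingCat.ofHom (algebraMap R (integralClosure R S)))
        (CommRingCat.ofHom (algebraMap R (pruferHull R S)))
        (CommRingCat.ofHom (integralClosureIncl R S))
        (CommRingCat.ofHom (pruferHullIncl R S)) ∧
      integralClosure R S ⊓ pruferHull R S = ⊥ ∧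
      extConductor (algebraMap R (integralClosure R S)) =
        (extConductor (pruferHullIncl R S)).comap (algebraMap R (pruferHull R S)) ∧
      extConductor (pruferHullIncl R S) =
        (extConductor (algebraMap R (integralClosure R S))).map
          (algebraMap R (pruferHull R S))) ∧
    -- the factorization of the extension
    (pruferIntegralHull R S =
        (integralClosure (pruferHull R S) S).restrictScalars R ∧
      quasiPruferHull R S =
        (pruferHull (integralClosure R S) S).restrictScalars R ∧
      quasiPruferHull R S = ⊤ ∧
      IsAlmostPruferExt R (pruferIntegralHull R S) ∧
      IsPruferExt (pruferIntegralHull R S) S) ∧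
    -- characterizations of almost-Prüfer extensions
    ((IsAlmostPruferExt R S ↔ integralClosure R S ⊔ pruferHull R S = ⊤) ∧
      (integralClosure R S ⊔ pruferHull R S = ⊤ ↔
        (pruferHull (integralClosure R S) S).restrictScalars R =
          (integralClosure (pruferHull R S) S).restrictScalars R)) ∧
    -- the greatest almost-Prüfer subextension, and its Prüfer hull
    (IsGreatest {T : Subalgebra R S | IsAlmostPruferExt R T} (pruferIntegralHull R S) ∧
      pruferHull R S =
        (pruferHull R (pruferIntegralHull R S)).map (pruferIntegralHull R S).val) ∧
    -- supports
    (IsAlmostPruferExt R S →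
      extSupp R S = extSupp R (pruferHull R S) ∪ extSupp R (integralClosure R S) ∧
      extMSupp R S = extMSupp R (pruferHull R S) ∪ extMSupp R (integralClosure R S)) := by
  have hinj := hRS.injective
  have hhull := isPruferExt_pruferHull hinj
  have htop : (pruferHull (integralClosure R S) S).restrictScalars R = ⊤ := by
    rw [pruferHull_eq_top hRS.prufer, Subalgebra.restrictScalars_top]
  have hqtop := quasiPruferHull_eq_top hRS
  refine ⟨isGreatest_pruferHull hinj, ⟨?_, fun _ hT => le_sSup hT⟩,
    ⟨isPushout_of_linearDisjoint (linearDisjoint_of_isPruferExt _ hhull).symm le_sup_right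
      le_sup_left (sup_comm ..), isPullback_of_inf_eq_bot hinj le_sup_right le_sup_left
      (integralClosure_inf_pruferHull hinj), integralClosure_inf_pruferHull hinj,
      extConductor_integralClosure hinj, ?_⟩,
    ⟨pruferIntegralHull_eq hRS, hqtop.trans htop.symm, hqtop,
      (isGreatest_pruferIntegralHull hRS).1, isPruferExt_pruferIntegralHull hRS⟩,
    ⟨isAlmostPruferExt_iff_sup_eq_top hRS, ?_⟩,
    ⟨isGreatest_pruferIntegralHull hRS, pruferHull_eq_map_pruferHull hinj le_sup_left⟩,
    fun hS => ?_⟩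
  · rw [hqtop]
    exact hRS.top
  -- The conductor in `R̃` is extended from its contraction to `R`, as is every ideal of `R̃`.
  · rw [extConductor_integralClosure hinj, hhull.map_comap_eq]
  · rw [htop, ← pruferIntegralHull_eq hRS, pruferIntegralHull, sup_comm, eq_comm]
  · have hsupp := extSupp_eq_union ((sup_comm ..).trans
      ((isAlmostPruferExt_iff_sup_eq_top hRS).1 hS))
    exact ⟨hsupp, by rw [extMSupp, hsupp, Set.union_inter_distrib_right]; rfl⟩
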